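/- For points $p,q$ of the Euclidean plane let $|pq|$ be their distance and let $D[p,q]$ be the closed disk having the segment $pq$ as a diameter. Let $P$ be a finite set of points in the plane and let $\mathcal{P}$ be a partition of $P$ into nonempty parts. For parts $A,B\in\mathcal{P}$ put $d(A,B)=\min\{|ab| : a\in A,\ b\in B\}$, and let $G(\mathcal{P})$ be the complete graph with vertex set $\mathcal{P}$ in which the edge $\{A,B\}$ has weight $d(A,B)$. Let $T$ be any minimum spanning tree of $G(\mathcal{P})$. For every edge $e=\{A,B\}$ of $T$ choose (breaking ties arbitrarily) points $a_e\in A$ and $b_e\in B$ with $|a_eb_e|=d(A,B)$, and let $\mathcal{D}=\{D[a_e,b_e] : e \text{ an edge of } T\}$. Then: 1. For every four distinct disks $D_1,D_2,D_3,D_4\in\mathcal{D}$, the disks have no common point outside $P$, that is, $(D_1\cap D_2\cap D_3\cap D_4)\setminus P=\emptyset$. 2. Consequently, every point of the plane that does not belong to $P$ lies in at most three disks of $\mathcal{D}$. 3. More precisely, if $e_1,e_2,e_3,e_4$ are four distinct edges of $T$ and $x$ is a point lying in all four disks $D[a_{e_i},b_{e_i}]$, then $x$ is a common endpoint of the four segments,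 i.e. $x\in\{a_{e_i},b_{e_i}\}$ for $i=1,2,3,4$. -/

import Mathlib

/-- The Euclidean plane. -/
abbrev Plane : Type := EuclideanSpace ℝ (Fin 2)

/-- The closed disk `D[a,b]` having the segment `ab` as a diameter. -/
noncomputable def diametralDisk (a b : Plane) : Set Plane :=
  Metric.closedBall (midpoint ℝ a b) (dist a b / 2)

/-- The distance `min {|ab| : a ∈ A, b ∈ B}` of two finite point sets
(the minimum exists, and equals this infimum, when both sets are nonempty). -/
noncomputable def partDist (A B : Finset Plane) : ℝ :=
  sInf (Set.image2 dist (A : Set Plane) (B : Set Plane))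

theorem partDist_comm (A B : Finset Plane) : partDist A B = partDist B A := by
  unfold partDist
  rw [Set.image2_swap]
  simp only [dist_comm]

/-- Total weight of a graph on a finite vertex set with respect to edge weights `w`. -/
noncomputable def graphWeight {V : Type*} [Fintype V] (w : Sym2 V → ℝ) (G : SimpleGraph V) : ℝ :=
  open Classical in ∑ e ∈ G.edgeFinset, w e

/-- `T` is a minimum spanning tree of the graph `G` with edge weights `w`. As `T` is a graph on
the whole vertex type, being a tree makes it a spanning tree. -/
def IsMinSpanningTree {V : Type*} [Fintype V] (G : SimpleGraph V) (w : Sym2 V → ℝ)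
    (T : SimpleGraph V) : Prop :=
  T ≤ G ∧ T.IsTree ∧
    ∀ T' : SimpleGraph V, T' ≤ G → T'.IsTree → graphWeight w T ≤ graphWeight w T'

section Partition

variable [DecidableEq Plane] {P : Finset Plane}

/-- The edge weights `w(P_i, P_j) = d(P_i, P_j)` of the complete graph on the parts. -/
noncomputable def partWeight (𝓠 : Finpartition P) : Sym2 𝓠.parts → ℝ :=
  Sym2.lift ⟨fun A B => partDist A.1 B.1, fun A B => partDist_comm A.1 B.1⟩

/-- `seg` assigns to every edge `{A, B}` of `T` a straight-line edge `(a, b)` realizing it, that is,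
`a ∈ A`, `b ∈ B` (for one of the two orders of `A`, `B`) and `|ab| = d(A, B)`.
Ties between closest pairs are broken arbitrarily. -/
def RealizesEdges (𝓠 : Finpartition P) (T : SimpleGraph 𝓠.parts)
    (seg : T.edgeSet → Plane × Plane) : Prop :=
  ∀ e : T.edgeSet, ∃ A B : 𝓠.parts, (e : Sym2 𝓠.parts) = s(A, B) ∧
    (seg e).1 ∈ A.1 ∧ (seg e).2 ∈ B.1 ∧ dist (seg e).1 (seg e).2 = partDist A.1 B.1

end Partition

/-- The set of closed disks having the straight-line edges `seg e` as diameters. -/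
def diskSet {ι : Type*} (seg : ι → Plane × Plane) : Set (Set Plane) :=
  {D | ∃ e, D = diametralDisk (seg e).1 (seg e).2}

/-!
Let `x` lie in the disks of four edges of the tree `T`, and take `x` as the origin. Being in the
disk of an edge means that the edge subtends an angle of at least `π / 2` at `x`, so that its
squared length is at least the sum of the squared distances of its ends from `x`
(`inner_sub_sub_nonpos_of_mem_diametralDisk`). Minimality of `T` enters through the exchange of
edges: if an edge `e` of `T` separates the parts of two points, these points are at distance at
least `|e|` (`IsMinSpanningTree.weight_le_of_not_reachable`).

Deleting the four edges leaves five components of `T`. In each component, among the eight given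
endpoints, choose one, `q`, that is nearest to `x`; let `p` be the nearest of all, with
`|p| = m`. On the tree path from the component of `q` to another chosen point `q'`, the first
deleted edge has one end in the component of `q`, so `|q - q'|² ≥ |q|² + m²`
(`IsSeparated.add_sq_le_norm_sub_sq`). Taking `q' = p`, this says that the four points `q` other
than `p` lie in the half-plane `⟪q, p⟫ ≤ 0`. If `m > 0`, it says moreover that the distance of
two of them exceeds both their norms, so that they form an angle of more than `π / 3`. Four such
directions do not fit into a half-plane (`no_four_wide_angles_in_halfplane`). Hence `p = x`.

If `p = x`, then the end of each edge which that edge separates from the part of `p` is at least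
as far from `x` as the edge is long. By the angle condition the other end is `x`
(`IsSeparated.exists_eq_zero`). The two statements about points outside `P` follow, because
distinct disks come from distinct edges and the ends of the edges belong to `P`.
-/

open SimpleGraph

/-! ### Deleting edges from a tree -/

theorem SimpleGraph.Preconnected.reachable_deleteEdges_or {V : Type*} {G : SimpleGraph V}
    (hG : G.Preconnected) (a b w : V) :
    (G.deleteEdges {s(a, b)}).Reachable w a ∨ (G.deleteEdges {s(a, b)}).Reachable w b := by
  obtain ⟨p⟩ := hG w a
  induction p with
  | nil => exact Or.inl .rfl
  | @cons u v z h p ih =>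
    by_cases he : s(u, v) = s(z, b)
    · rcases Sym2.eq_iff.1 he with ⟨rfl, -⟩ | ⟨rfl, -⟩
      · exact Or.inl .rfl
      · exact Or.inr .rfl
    · have huv : (G.deleteEdges {s(z, b)}).Reachable u v :=
        Adj.reachable (by simpa [deleteEdges_adj, h] using he)
      exact ih.imp huv.trans huv.trans

/-- The edge `s(x, y)` is the first deleted edge on the path from `u` to `v`; as a tree path is
unique, that edge by itself already separates `u` from `v`. -/
theorem SimpleGraph.IsAcyclic.exists_separating_edge {V : Type*} {G : SimpleGraph V}
    (hG : G.IsAcyclic) {s : Set (Sym2 V)} {u v : V} (huv : G.Reachable u v)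
    (hs : ¬ (G.deleteEdges s).Reachable u v) :
    ∃ x y, s(x, y) ∈ s ∧ (G.deleteEdges s).Reachable u x ∧
      ¬ (G.deleteEdges {s(x, y)}).Reachable u v := by
  classical
  obtain ⟨p, hp⟩ := huv.exists_isPath
  induction p with
  | nil => exact absurd .rfl hs
  | @cons u w v h p ih =>
    rw [Walk.cons_isPath_iff] at hp
    by_cases he : s(u, w) ∈ s
    · refine ⟨u, w, he, .rfl, fun hr => ?_⟩
      have hwv : (G.deleteEdges {s(u, w)}).Reachable w v :=
        reachable_deleteEdges_iff_exists_walk.2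
          ⟨p, fun hmem => hp.2 (p.fst_mem_support_of_mem_edges hmem)⟩
      exact isBridge_iff.1 (isAcyclic_iff_forall_isBridge.1 hG (G.mem_edgeSet.2 h))
        (hr.trans hwv.symm)
    · have huw : (G.deleteEdges s).Reachable u w :=
        Adj.reachable (by simpa [deleteEdges_adj, h] using he)
      obtain ⟨x, y, hxy, hwx, hsep⟩ := ih p.reachable (fun hr => hs (huw.trans hr)) hp.1
      refine ⟨x, y, hxy, huw.trans hwx, fun hr => hsep (.trans (Adj.reachable ?_) hr)⟩
      rw [deleteEdges_adj]
      exact ⟨h.symm, fun hmem => he (by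
        rw [Set.mem_singleton_iff] at hmem
        rwa [Sym2.eq_swap, hmem])⟩

/-- In a graph with two deleted edges `a b` and `c d`, the far endpoints `a` and `c` as seen from
a root `r` lie in different components: a walk from `r` to `b` avoiding `a b` would have to cross
`c d`, and would then connect `r` to `a` after all. -/
theorem SimpleGraph.not_reachable_far_endpoints {V : Type*} {G : SimpleGraph V}
    (hG : G.Preconnected) {s : Set (Sym2 V)} {r a b c d : V} (hab : G.Adj a b)
    (hs : s(a, b) ∈ s) (hs' : s(c, d) ∈ s) (hne : s(a, b) ≠ s(c, d))
    (ha : ¬ (G.deleteEdges {s(a, b)}).Reachable r a)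
    (hc : ¬ (G.deleteEdges {s(c, d)}).Reachable r c) :
    ¬ (G.deleteEdges s).Reachable a c := by
  classical
  intro hac
  have hmono : ∀ {e : Sym2 V}, e ∈ s → (G.deleteEdges {e}).Reachable a c := fun he =>
    hac.mono (deleteEdges_anti (Set.singleton_subset_iff.2 he))
  obtain ⟨p, hp⟩ := reachable_deleteEdges_iff_exists_walk.1
    ((hG.reachable_deleteEdges_or a b r).resolve_left ha)
  by_cases hmem : s(c, d) ∈ p.edges
  · have hcp := p.fst_mem_support_of_mem_edges hmem
    have hrc : (G.deleteEdges {s(a, b)}).Reachable r c :=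
      reachable_deleteEdges_iff_exists_walk.2
        ⟨p.takeUntil c hcp, fun h => hp (p.edges_takeUntil_subset_edges hcp h)⟩
    exact ha (hrc.trans (hmono hs).symm)
  · have hrb : (G.deleteEdges {s(c, d)}).Reachable r b :=
      reachable_deleteEdges_iff_exists_walk.2 ⟨p, hmem⟩
    have hba : (G.deleteEdges {s(c, d)}).Reachable b a :=
      Adj.reachable (by
        rw [deleteEdges_adj, Set.mem_singleton_iff, Sym2.eq_swap]
        exact ⟨hab.symm, hne⟩)
    exact hc ((hrb.trans hba).trans (hmono hs'))

theorem SimpleGraph.IsTree.exchange {V : Type*} {T : SimpleGraph V} (hT : T.IsTree)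
    {a b u v : V} (huv : ¬ (T.deleteEdges {s(a, b)}).Reachable u v) :
    (T.deleteEdges {s(a, b)} ⊔ edge u v).IsTree := by
  have hle : T.deleteEdges {s(a, b)} ≤ T.deleteEdges {s(a, b)} ⊔ edge u v := le_sup_left
  have hne : u ≠ v := fun h => huv (h ▸ .rfl)
  have huv' : (T.deleteEdges {s(a, b)} ⊔ edge u v).Reachable u v :=
    Adj.reachable (Or.inr (by simp [edge_adj, hne]))
  have hor := hT.connected.preconnected.reachable_deleteEdges_or a b
  have hab : (T.deleteEdges {s(a, b)} ⊔ edge u v).Reachable a b := by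
    rcases hor u with hu | hu <;> rcases hor v with hv | hv
    · exact absurd (hu.trans hv.symm) huv
    · exact ((hu.mono hle).symm.trans huv').trans (hv.mono hle)
    · exact ((hv.mono hle).symm.trans huv'.symm).trans (hu.mono hle)
    · exact absurd (hu.trans hv.symm) huv
  have hreach : ∀ w, (T.deleteEdges {s(a, b)} ⊔ edge u v).Reachable a w := fun w =>
    (hor w).elim (fun h => (h.mono hle).symm) fun h => hab.trans (h.mono hle).symm
  exact ⟨(connected_iff_exists_forall_reachable _).2 ⟨a, hreach⟩,
    (hT.isAcyclic.anti (deleteEdges_le _)).sup_edge_of_not_reachable huv⟩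

/-- The cut property of minimum spanning trees: an edge of the tree is a lightest one among all
edges across the cut that it defines. -/
theorem IsMinSpanningTree.weight_le_of_not_reachable {V : Type*} [Fintype V] {w : Sym2 V → ℝ}
    {T : SimpleGraph V} (hT : IsMinSpanningTree ⊤ w T) {a b u v : V} (hab : T.Adj a b)
    (huv : ¬ (T.deleteEdges {s(a, b)}).Reachable u v) : w s(a, b) ≤ w s(u, v) := by
  classical
  have h := hT.2.2 _ le_top (hT.2.1.exchange huv)
  have hne : u ≠ v := fun h => huv (h ▸ .rfl)
  have h1 : (T.deleteEdges {s(a, b)} ⊔ edge u v).edgeFinset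
      = insert s(u, v) (T.edgeFinset.erase s(a, b)) := by
    ext e
    simp only [mem_edgeFinset, edgeSet_sup, edgeSet_deleteEdges, edgeSet_edge_of_ne hne,
      Finset.mem_insert, Finset.mem_erase, Set.mem_union, Set.mem_sdiff, Set.mem_singleton_iff]
    tauto
  have h2 : s(u, v) ∉ T.edgeFinset.erase s(a, b) := by
    intro hmem
    rw [Finset.mem_erase, mem_edgeFinset, mem_edgeSet] at hmem
    exact huv (Adj.reachable (by simpa [deleteEdges_adj, hmem.2] using hmem.1))
  have h3 : ∑ e ∈ T.edgeFinset, w e ≤ w s(u, v) + ∑ e ∈ T.edgeFinset.erase s(a, b), w e := by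
    rw [← Finset.sum_insert h2, ← h1]
    unfold graphWeight at h
    convert h
  rw [← Finset.add_sum_erase _ w (mem_edgeFinset.2 (T.mem_edgeSet.2 hab))] at h3
  linarith

/-! ### Plane geometry -/

theorem inner_sub_sub_nonpos_of_mem_diametralDisk {x a b : Plane} (hx : x ∈ diametralDisk a b) :
    inner ℝ (a - x) (b - x) ≤ 0 := by
  rw [diametralDisk, Metric.mem_closedBall, dist_eq_norm, dist_eq_norm] at hx
  have h1 : x - midpoint ℝ a b = -((1 / 2 : ℝ) • ((a - x) + (b - x))) := by
    rw [midpoint_eq_smul_add, invOf_eq_inv]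
    module
  have h2 : a - b = (a - x) - (b - x) := by abel
  rw [h1, h2, norm_neg, norm_smul, Real.norm_of_nonneg (by norm_num)] at hx
  have h3 : ‖(a - x) + (b - x)‖ ^ 2 ≤ ‖(a - x) - (b - x)‖ ^ 2 := by
    gcongr
    linarith
  rw [norm_add_sq_real (a - x), norm_sub_sq_real (a - x)] at h3
  linarith

/-- A closed half-plane does not contain four vectors which pairwise form angles of more than
`π / 3`. The bound on the inner products says that the third side of the triangle spanned by
`v i` and `v j` is the strictly longest one. -/
theorem no_four_wide_angles_in_halfplane {p : Plane} (hp : p ≠ 0) (v : Fin 4 → Plane)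
    (hv : ∀ i, inner ℝ (v i) p ≤ 0)
    (hvv : ∀ i j, i ≠ j → 2 * inner ℝ (v i) (v j) < ‖v i‖ ^ 2) : False := by
  -- Rotate and scale the plane so that the half-plane becomes the upper half-plane of `ℂ`.
  let w : Fin 4 → ℂ := fun i => ⟨p 0 * v i 1 - p 1 * v i 0, -(p 0 * v i 0 + p 1 * v i 1)⟩
  have hin : ∀ x y : Plane, inner ℝ x y = x 0 * y 0 + x 1 * y 1 := by
    intro x y
    simp [PiLp.inner_apply, Fin.sum_univ_two, mul_comm]
  have hns : ∀ x : Plane, ‖x‖ ^ 2 = x 0 ^ 2 + x 1 ^ 2 := by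
    intro x
    rw [← real_inner_self_eq_norm_sq, hin]
    ring
  have him : ∀ i, 0 ≤ (w i).im := by
    intro i
    have := hv i
    rw [hin] at this
    change 0 ≤ -(p 0 * v i 0 + p 1 * v i 1)
    linarith
  have hw : ∀ i j, (w i).re * (w j).re + (w i).im * (w j).im = ‖p‖ ^ 2 * inner ℝ (v i) (v j) := by
    intro i j
    rw [hin, hns]
    simp only [w]
    ring
  have hwn : ∀ i, ‖w i‖ ^ 2 = ‖p‖ ^ 2 * ‖v i‖ ^ 2 := by
    intro i
    rw [← real_inner_self_eq_norm_sq (v i), ← hw, Complex.sq_norm, Complex.normSq_apply]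
  -- Two of the four arguments lie in the same third of `[0, π]`.
  have hbox : ∃ i j, i ≠ j ∧ |(w i).arg - (w j).arg| ≤ Real.pi / 3 := by
    let f : Fin 4 → Fin 3 := fun i =>
      if (w i).arg ≤ Real.pi / 3 then 0 else if (w i).arg ≤ 2 * Real.pi / 3 then 1 else 2
    obtain ⟨i, j, hij, hf⟩ := Fintype.exists_ne_map_eq_of_card_lt f (by simp)
    refine ⟨i, j, hij, ?_⟩
    have hi0 := Complex.arg_nonneg_iff.2 (him i)
    have hj0 := Complex.arg_nonneg_iff.2 (him j)
    have hi1 := Complex.arg_le_pi (w i)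
    have hj1 := Complex.arg_le_pi (w j)
    simp only [f] at hf
    rw [abs_le]
    split_ifs at hf <;> first | (exfalso; revert hf; decide) | (constructor <;> linarith)
  obtain ⟨i, j, hij, harg⟩ := hbox
  have hcos : 1 / 2 ≤ Real.cos ((w i).arg - (w j).arg) := by
    rw [← Real.cos_pi_div_three, ← Real.cos_abs ((w i).arg - (w j).arg)]
    exact Real.cos_le_cos_of_nonneg_of_le_pi (abs_nonneg _) (by linarith [Real.pi_pos]) harg
  have hprod : ‖w i‖ * ‖w j‖ * Real.cos ((w i).arg - (w j).arg)
      = ‖p‖ ^ 2 * inner ℝ (v i) (v j) := by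
    rw [← hw, ← Complex.norm_mul_cos_arg (w i), ← Complex.norm_mul_cos_arg (w j),
      ← Complex.norm_mul_sin_arg (w i), ← Complex.norm_mul_sin_arg (w j), Real.cos_sub]
    ring
  have hp2 : 0 < ‖p‖ ^ 2 := by positivity
  have hmin : ‖w i‖ * ‖w j‖ < ‖w i‖ ^ 2 ∧ ‖w i‖ * ‖w j‖ < ‖w j‖ ^ 2 := by
    have h1 := mul_lt_mul_of_pos_left (hvv i j hij) hp2
    have h2 := mul_lt_mul_of_pos_left (hvv j i hij.symm) hp2
    rw [real_inner_comm] at h2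
    have h3 := mul_le_mul_of_nonneg_left hcos (mul_nonneg (norm_nonneg (w i)) (norm_nonneg (w j)))
    rw [← hwn] at h1 h2
    constructor <;> linarith
  have := norm_nonneg (w i)
  have := norm_nonneg (w j)
  rcases le_total ‖w i‖ ‖w j‖ with h | h <;> nlinarith

/-! ### Four edges of a tree embedded in the plane -/

section Separated

variable {V ι : Type*} {T : SimpleGraph V} {vtx : ι × Bool → V} {pt : ι × Bool → Plane}

/-- The graph obtained from `T` by deleting, for every index `i`, the edge joining `vtx (i, false)`
and `vtx (i, true)`. -/
def remainingForest (T : SimpleGraph V) (vtx : ι × Bool → V) : SimpleGraph V :=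
  T.deleteEdges (Set.range fun i => s(vtx (i, false), vtx (i, true)))

/-- Any two of the points `pt k` whose vertices are separated by the edge with index `i` are at
least as far apart as the two points representing the ends of that edge. -/
def IsSeparated (T : SimpleGraph V) (vtx : ι × Bool → V) (pt : ι × Bool → Plane) : Prop :=
  ∀ i k l, ¬ (T.deleteEdges {s(vtx (i, false), vtx (i, true))}).Reachable (vtx k) (vtx l) →
    ‖pt (i, false) - pt (i, true)‖ ≤ ‖pt k - pt l‖

/-- If the edges of `T` indexed by `ι` subtend angles of at least `π / 2` at the origin and `k` is
the index of a point nearest to the origin in its component, then the point of any other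
component is far away from it. Here `m` is any lower bound for the norms of the points. -/
theorem IsSeparated.add_sq_le_norm_sub_sq (hT : T.IsTree) (hsep : IsSeparated T vtx pt)
    (hobt : ∀ i, inner ℝ (pt (i, false)) (pt (i, true)) ≤ 0) {m : ℝ} (hm0 : 0 ≤ m)
    (hm : ∀ k, m ≤ ‖pt k‖) {k l : ι × Bool}
    (hk : ∀ k', (remainingForest T vtx).Reachable (vtx k) (vtx k') → ‖pt k‖ ≤ ‖pt k'‖)
    (hkl : ¬ (remainingForest T vtx).Reachable (vtx k) (vtx l)) :
    ‖pt k‖ ^ 2 + m ^ 2 ≤ ‖pt k - pt l‖ ^ 2 := by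
  obtain ⟨x, y, ⟨i, hi⟩, hkx, hxy⟩ := hT.isAcyclic.exists_separating_edge
    (hT.connected.preconnected (vtx k) (vtx l)) hkl
  dsimp only at hi
  have hle := hsep i k l (by rwa [hi])
  have hsq : ‖pt (i, false)‖ ^ 2 + ‖pt (i, true)‖ ^ 2 ≤ ‖pt k - pt l‖ ^ 2 :=
    calc _ ≤ ‖pt (i, false) - pt (i, true)‖ ^ 2 := by
          rw [norm_sub_sq_real]
          linarith [hobt i]
      _ ≤ _ := by gcongr
  have key : ∀ a b, vtx (i, a) = x → ‖pt k‖ ^ 2 + m ^ 2 ≤ ‖pt (i, a)‖ ^ 2 + ‖pt (i, b)‖ ^ 2 := by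
    intro a b ha
    have h1 := hk (i, a) (ha ▸ hkx)
    have h2 := hm (i, b)
    gcongr
  rcases Sym2.eq_iff.1 hi with ⟨h, -⟩ | ⟨-, h⟩
  · exact (key false true h).trans hsq
  · exact ((key true false h).trans_eq (add_comm _ _)).trans hsq

theorem exists_far_endpoint (hT : T.IsAcyclic)
    (hadj : ∀ i, T.Adj (vtx (i, false)) (vtx (i, true))) (r : V) (i : ι) :
    ∃ s : Bool, ¬ (T.deleteEdges {s(vtx (i, false), vtx (i, true))}).Reachable r (vtx (i, s)) := by
  by_contra! h
  exact isBridge_iff.1 (isAcyclic_iff_forall_isBridge.1 hT (T.mem_edgeSet.2 (hadj i)))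
    ((h false).symm.trans (h true))

/-- If one of the points is the origin, every far endpoint is at least as far from it as its edge
is long; as the edge subtends an angle of at least `π / 2`, its other end is the origin too. -/
theorem IsSeparated.exists_eq_zero (hT : T.IsTree)
    (hadj : ∀ i, T.Adj (vtx (i, false)) (vtx (i, true))) (hsep : IsSeparated T vtx pt)
    (hobt : ∀ i, inner ℝ (pt (i, false)) (pt (i, true)) ≤ 0) {k : ι × Bool} (hk : pt k = 0)
    (i : ι) : pt (i, false) = 0 ∨ pt (i, true) = 0 := by
  obtain ⟨s, hs⟩ := exists_far_endpoint hT.isAcyclic hadj (vtx k) i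
  have h := hsep i k (i, s) hs
  rw [hk, zero_sub, norm_neg] at h
  have h2 : ‖pt (i, false) - pt (i, true)‖ ^ 2 ≤ ‖pt (i, s)‖ ^ 2 := by gcongr
  rw [norm_sub_sq_real] at h2
  have h3 := hobt i
  cases s
  · refine Or.inr (norm_eq_zero.1 (pow_eq_zero_iff two_ne_zero |>.1 ?_))
    nlinarith [sq_nonneg ‖pt (i, true)‖]
  · refine Or.inl (norm_eq_zero.1 (pow_eq_zero_iff two_ne_zero |>.1 ?_))
    nlinarith [sq_nonneg ‖pt (i, false)‖]

/-- The nearest points of the four components not containing `k` would lie in a half-plane and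
pairwise form angles of more than `π / 3`. -/
theorem IsSeparated.eq_zero_of_forall_norm_le {vtx : Fin 4 × Bool → V} {pt : Fin 4 × Bool → Plane}
    (hT : T.IsTree) (hadj : ∀ i, T.Adj (vtx (i, false)) (vtx (i, true)))
    (hinj : Function.Injective fun i => s(vtx (i, false), vtx (i, true)))
    (hsep : IsSeparated T vtx pt) (hobt : ∀ i, inner ℝ (pt (i, false)) (pt (i, true)) ≤ 0)
    {k : Fin 4 × Bool} (hk : ∀ l, ‖pt k‖ ≤ ‖pt l‖) : pt k = 0 := by
  by_contra hk0
  choose s hs using exists_far_endpoint hT.isAcyclic hadj (vtx k)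
  have hmem : ∀ i, s(vtx (i, false), vtx (i, true)) ∈
      Set.range fun i => s(vtx (i, false), vtx (i, true)) := fun i => ⟨i, rfl⟩
  -- `s i` tells which end of the edge `i` is the far one; the edge itself does not depend on it.
  have hflip : ∀ i, s(vtx (i, s i), vtx (i, !s i)) = s(vtx (i, false), vtx (i, true)) := by
    intro i
    cases s i
    · rfl
    · exact Sym2.eq_swap
  have hroot : ∀ i, ¬ (remainingForest T vtx).Reachable (vtx k) (vtx (i, s i)) := fun i h =>
    hs i (h.mono (deleteEdges_anti (Set.singleton_subset_iff.2 (hmem i))))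
  have hfar : ∀ i j, i ≠ j →
      ¬ (remainingForest T vtx).Reachable (vtx (i, s i)) (vtx (j, s j)) := by
    intro i j hij
    refine not_reachable_far_endpoints hT.connected.preconnected (r := vtx k)
      (b := vtx (i, !s i)) (d := vtx (j, !s j)) ?_ ?_ ?_ ?_ ?_ ?_
    · rw [← mem_edgeSet, hflip]
      exact hadj i
    · rw [hflip]
      exact hmem i
    · rw [hflip]
      exact hmem j
    · rw [hflip, hflip]
      exact fun h => hij (hinj h)
    · rw [hflip]
      exact hs i
    · rw [hflip]
      exact hs j
  have hnear : ∀ i, ∃ q, (remainingForest T vtx).Reachable (vtx (i, s i)) (vtx q) ∧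
      ∀ q', (remainingForest T vtx).Reachable (vtx q) (vtx q') → ‖pt q‖ ≤ ‖pt q'‖ := by
    intro i
    obtain ⟨q, hq, hmin⟩ := Set.exists_min_image
      {q | (remainingForest T vtx).Reachable (vtx (i, s i)) (vtx q)} (fun q => ‖pt q‖)
      (Set.toFinite _) ⟨(i, s i), .rfl⟩
    exact ⟨q, hq, fun q' hq' => hmin q' (hq.trans hq')⟩
  choose q hq hqmin using hnear
  have hpos : 0 < ‖pt k‖ ^ 2 := by positivity
  have hlow := fun {i : Fin 4} {l} => hsep.add_sq_le_norm_sub_sq hT hobt (norm_nonneg (pt k)) hk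
    (l := l) (hqmin i)
  refine no_four_wide_angles_in_halfplane hk0 (fun i => pt (q i)) (fun i => ?_)
    fun i j hij => ?_
  · have h := hlow (i := i) (l := k) fun h => hroot i ((hq i).trans h).symm
    rw [norm_sub_sq_real] at h
    linarith
  · have h := hlow (i := j) (l := q i) fun h =>
      hfar i j hij (((hq j).trans h).trans (hq i).symm).symm
    rw [norm_sub_sq_real, real_inner_comm] at h
    linarith

end Separated

/-! ### Disks of a minimum spanning tree -/

theorem partDist_le_dist {A B : Finset Plane} {a b : Plane} (ha : a ∈ A) (hb : b ∈ B) :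
    partDist A B ≤ dist a b := by
  refine csInf_le ⟨0, ?_⟩ ⟨a, ha, b, hb, rfl⟩
  rintro _ ⟨x, -, y, -, rfl⟩
  exact dist_nonneg

theorem RealizesEdges.fst_mem_and_snd_mem [DecidableEq Plane] {P : Finset Plane}
    {𝓠 : Finpartition P} {T : SimpleGraph 𝓠.parts} {seg : T.edgeSet → Plane × Plane}
    (hseg : RealizesEdges 𝓠 T seg) (e : T.edgeSet) : (seg e).1 ∈ P ∧ (seg e).2 ∈ P := by
  obtain ⟨A, B, -, hA, hB, -⟩ := hseg e
  exact ⟨𝓠.le A.2 hA, 𝓠.le B.2 hB⟩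

theorem eq_endpoint_of_mem_four_disks [DecidableEq Plane] {P : Finset Plane}
    {𝓠 : Finpartition P} {T : SimpleGraph 𝓠.parts} (hT : IsMinSpanningTree ⊤ (partWeight 𝓠) T)
    {seg : T.edgeSet → Plane × Plane} (hseg : RealizesEdges 𝓠 T seg) (e : Fin 4 → T.edgeSet)
    (he : Function.Injective e) (x : Plane)
    (hx : ∀ i, x ∈ diametralDisk (seg (e i)).1 (seg (e i)).2) (i : Fin 4) :
    x = (seg (e i)).1 ∨ x = (seg (e i)).2 := by
  choose A B hAB hA hB hd using fun i => hseg (e i)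
  let vtx : Fin 4 × Bool → 𝓠.parts := fun k => cond k.2 (B k.1) (A k.1)
  let pt : Fin 4 × Bool → Plane := fun k => cond k.2 (seg (e k.1)).2 (seg (e k.1)).1 - x
  have hadj : ∀ i, T.Adj (vtx (i, false)) (vtx (i, true)) := fun i => by
    have := (e i).2
    rwa [hAB i] at this
  have hinj : Function.Injective fun i => s(vtx (i, false), vtx (i, true)) := fun i j hij =>
    he (Subtype.ext ((hAB i).trans (Eq.trans hij (hAB j).symm)))
  have hmem : ∀ k, pt k + x ∈ (vtx k).1 := by
    rintro ⟨i, _ | _⟩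
    · simpa [pt, vtx] using hA i
    · simpa [pt, vtx] using hB i
  have hsep : IsSeparated T vtx pt := by
    intro i k l hkl
    have h1 := hT.weight_le_of_not_reachable (hadj i) hkl
    have h2 := partDist_le_dist (hmem k) (hmem l)
    have h3 : ‖pt (i, false) - pt (i, true)‖ = partWeight 𝓠 s(vtx (i, false), vtx (i, true)) := by
      simp only [pt, cond_true, cond_false, sub_sub_sub_cancel_right]
      rw [← dist_eq_norm, hd]
      rfl
    rw [dist_add_right, dist_eq_norm] at h2
    rw [h3]
    exact h1.trans h2
  have hobt : ∀ i, inner ℝ (pt (i, false)) (pt (i, true)) ≤ 0 := fun i =>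
    inner_sub_sub_nonpos_of_mem_diametralDisk (hx i)
  obtain ⟨k, hk⟩ := Finite.exists_min fun k => ‖pt k‖
  refine (hsep.exists_eq_zero hT.2.1 hadj hobt
    (hsep.eq_zero_of_forall_norm_le hT.2.1 hadj hinj hobt hk) i).imp ?_ ?_
  · exact fun h => (sub_eq_zero.1 h).symm
  · exact fun h => (sub_eq_zero.1 h).symm

/-- Distinct disks belong to distinct edges, and the endpoints of these edges are points of `P`. -/
theorem mem_of_mem_four_disks [DecidableEq Plane] {P : Finset Plane}
    {𝓠 : Finpartition P} {T : SimpleGraph 𝓠.parts} (hT : IsMinSpanningTree ⊤ (partWeight 𝓠) T)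
    {seg : T.edgeSet → Plane × Plane} (hseg : RealizesEdges 𝓠 T seg) {D : Fin 4 → Set Plane}
    (hD : Function.Injective D) (hmem : ∀ i, D i ∈ diskSet seg) {x : Plane} (hx : ∀ i, x ∈ D i) :
    x ∈ P := by
  choose e he using hmem
  have hinj : Function.Injective e := fun i j hij => hD (by rw [he i, he j, hij])
  rcases eq_endpoint_of_mem_four_disks hT hseg e hinj x (fun i => he i ▸ hx i) 0 with h | h
  · exact h ▸ (hseg.fst_mem_and_snd_mem (e 0)).1
  · exact h ▸ (hseg.fst_mem_and_snd_mem (e 0)).2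

theorem mainTheorem3 [DecidableEq Plane] (P : Finset Plane) (𝓠 : Finpartition P)
    (T : SimpleGraph 𝓠.parts) (hT : IsMinSpanningTree ⊤ (partWeight 𝓠) T)
    (seg : T.edgeSet → Plane × Plane) (hseg : RealizesEdges 𝓠 T seg) :
    (∀ D₁ ∈ diskSet seg, ∀ D₂ ∈ diskSet seg, ∀ D₃ ∈ diskSet seg, ∀ D₄ ∈ diskSet seg,
      D₁ ≠ D₂ → D₁ ≠ D₃ → D₁ ≠ D₄ → D₂ ≠ D₃ → D₂ ≠ D₄ → D₃ ≠ D₄ →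
      (D₁ ∩ D₂ ∩ D₃ ∩ D₄) \ (P : Set Plane) = ∅) ∧
    (∀ x : Plane, x ∉ P → {D ∈ diskSet seg | x ∈ D}.encard ≤ 3) ∧
    (∀ e : Fin 4 → T.edgeSet, Function.Injective e → ∀ x : Plane,
      (∀ i, x ∈ diametralDisk (seg (e i)).1 (seg (e i)).2) →
      ∀ i, x = (seg (e i)).1 ∨ x = (seg (e i)).2) := by
  refine ⟨?_, ?_, fun e he x hx i => eq_endpoint_of_mem_four_disks hT hseg e he x hx i⟩
  · intro D₁ h₁ D₂ h₂ D₃ h₃ D₄ h₄ h12 h13 h14 h23 h24 h34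
    rw [Set.sdiff_eq_empty]
    rintro x ⟨⟨⟨hx₁, hx₂⟩, hx₃⟩, hx₄⟩
    refine mem_of_mem_four_disks hT hseg (D := ![D₁, D₂, D₃, D₄]) ?_ ?_ ?_
    · intro i j hij
      fin_cases i <;> fin_cases j <;> simp_all
    · intro i
      fin_cases i <;> assumption
    · intro i
      fin_cases i <;> assumption
  · intro x hxP
    by_contra! h
    obtain ⟨t, ht, hcard⟩ := Set.exists_subset_encard_eq (Order.add_one_le_of_lt h)
    have hcard' : t.encard = (4 : ℕ) := by
      rw [hcard]
      norm_num
    have htfin : t.Finite := Set.finite_of_encard_eq_coe hcard'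
    have : Finite t := htfin
    have hnat : Nat.card t = 4 := by
      rw [Nat.card_coe_set_eq, Set.ncard, hcard']
      rfl
    let f := (Finite.equivFinOfCardEq hnat).symm
    exact hxP (mem_of_mem_four_disks hT hseg (D := fun i => (f i : Set Plane))
      (Subtype.val_injective.comp f.injective) (fun i => (ht (f i).2).1) fun i => (ht (f i).2).2)
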